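/- Let $A=(a_{i,j})\in\mathbb R^{n\times n}$ be an irreducible L-matrix (i.e. $a_{i,j}\le 0$ for $i\ne j$ and $a_{i,i}>0$; irreducible means that no simultaneous permutation of rows and columns brings $A$ to block upper triangular form with two nonempty square diagonal blocks), normalized so that $a_{i,i}=1$ for all $i$. For a real matrix $B=D-L-U$ with $D$ its diagonal part, $-L$ its strictly lower and $-U$ its strictly upper triangular part, let $$\mathscr L_{\gamma,\omega}(B)=(D-\gamma L)^{-1}\big[(1-\omega)D+(\omega-\gamma)L+\omega U\big]$$ be its AOR iteration matrix, where $0<\omega\le 1$ and $0\le\gamma\le 1$, and let $\rho$ denote the spectral radius. Let $2\le r\le n$, let $\alpha_1,\dots,\alpha_{r-1}\ge 0$ with $\sum_{k=1}^{r-1}\alpha_k a_{k,r}\ne 0$, let $Q_{15}$ be the $n\times n$ matrix whose $(k,r)$ entry is $-\alpha_k a_{k,r}$ for $k=1,\dots,r-1$ and whose other entries are $0$, and put $A^{(15)}=(I+Q_{15})A$. Write $\alpha_k\lesssim 1$ if $\alpha_k<1$, or $\alpha_k=1$ and $A^{(15)}$ is irreducible. Suppose that $\alpha_k a_{k,r}a_{r,k}<1$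 for $k=1,\dots,r-1$ and that one of the following conditions is satisfied: (i) $0\le\gamma<1$ and $0\le\alpha_k\lesssim 1$ for $k=1,\dots,r-1$. (ii) $\gamma=1$, $0\le\alpha_k\lesssim 1$ for $k=1,\dots,r-1$, and one of the following holds: (ii$_1$) there exist $i\in\{1,\dots,r-1\}$ and $j\in\{1,\dots,i\}\cup\{r+1,\dots,n\}$ such that $\alpha_i a_{i,r}a_{r,j}>0$; (ii$_2$) $a_{r-1,r}<0$ and $\alpha_{r-1}>0$; (ii$_3$) $a_{r,1}<0$; (ii$_4$) there exists $k\in\{r+1,\dots,n\}$ such that $a_{r,k}<0$. (iii) $r=n$, $0\le\gamma<1$ and $0<\alpha_k\le 1$ for $k=1,\dots,n-1$. (iv) $r=n$, $\gamma=1$, $0<\alpha_k\le 1$ for $k=1,\dots,n-1$, and one of the following holds: (iv$_1$) there exist $i\in\{1,\dots,n-1\}$ and $j\in\{1,\dots,i\}$ such that $a_{i,n}a_{n,j}>0$; (iv$_2$) $a_{n-1,n}<0$; (iv$_3$) $a_{n,1}<0$. Then one of the following (mutually exclusive) relations is valid: (a) $\rho(\mathscr L_{\gamma,\omega}(A^{(15)}))<\rho(\mathscr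 L_{\gamma,\omega}(A))<1$; (b) $\rho(\mathscr L_{\gamma,\omega}(A^{(15)}))=\rho(\mathscr L_{\gamma,\omega}(A))=1$; (c) $\rho(\mathscr L_{\gamma,\omega}(A^{(15)}))>\rho(\mathscr L_{\gamma,\omega}(A))>1$. -/

import Mathlib

open scoped ENNReal

namespace PrecAOR

/-- Z-matrix: all off-diagonal entries are nonpositive. -/
def IsZMatrix {n : ℕ} (B : Matrix (Fin n) (Fin n) ℝ) : Prop :=
  ∀ i j, i ≠ j → B i j ≤ 0

/-- L-matrix: a Z-matrix with positive diagonal. -/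
def IsLMatrix {n : ℕ} (B : Matrix (Fin n) (Fin n) ℝ) : Prop :=
  IsZMatrix B ∧ ∀ i, 0 < B i i

/-- `B` is reducible: after a simultaneous permutation of rows and columns it is block upper
triangular, with a zero block in rows `m, …, n-1` and columns `0, …, m-1`, where `1 ≤ m ≤ n-1`. -/
def IsReducible {n : ℕ} (B : Matrix (Fin n) (Fin n) ℝ) : Prop :=
  ∃ (σ : Equiv.Perm (Fin n)) (m : ℕ), 1 ≤ m ∧ m < n ∧
    ∀ i j : Fin n, m ≤ (i : ℕ) → (j : ℕ) < m → B.submatrix σ σ i j = 0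

def IsIrreducible {n : ℕ} (B : Matrix (Fin n) (Fin n) ℝ) : Prop :=
  ¬ IsReducible B

/-- The matrices of the decomposition `B = D - L - U`. -/
def diagPart {n : ℕ} (B : Matrix (Fin n) (Fin n) ℝ) : Matrix (Fin n) (Fin n) ℝ :=
  Matrix.diagonal fun i => B i i

def lowerPart {n : ℕ} (B : Matrix (Fin n) (Fin n) ℝ) : Matrix (Fin n) (Fin n) ℝ :=
  Matrix.of fun i j => if j < i then -B i j else 0

def upperPart {n : ℕ} (B : Matrix (Fin n) (Fin n) ℝ) : Matrix (Fin n) (Fin n) ℝ :=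
  Matrix.of fun i j => if i < j then -B i j else 0

/-- The AOR iteration matrix `(D - γ L)⁻¹ [(1 - ω) D + (ω - γ) L + ω U]` of `B`. -/
noncomputable def aor {n : ℕ} (γ ω : ℝ) (B : Matrix (Fin n) (Fin n) ℝ) :
    Matrix (Fin n) (Fin n) ℝ :=
  (diagPart B - γ • lowerPart B)⁻¹ *
    ((1 - ω) • diagPart B + (ω - γ) • lowerPart B + ω • upperPart B)

/-- The spectral radius of a real matrix: the largest modulus of its complex eigenvalues. -/
noncomputable def rho {n : ℕ} (B : Matrix (Fin n) (Fin n) ℝ) : ℝ≥0∞ :=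
  spectralRadius ℂ (B.map ((↑) : ℝ → ℂ))

/-- The matrix with entries `-α_k a_{k,r}` in column `r` above the diagonal, zero elsewhere. -/
def Q15 {n : ℕ} (A : Matrix (Fin n) (Fin n) ℝ) (r : Fin n) (α : Fin n → ℝ) :
    Matrix (Fin n) (Fin n) ℝ :=
  Matrix.of fun i j => if i < r ∧ j = r then -(α i * A i r) else 0

/-- The preconditioned matrix `(I + Q) A`. -/
def A15 {n : ℕ} (A : Matrix (Fin n) (Fin n) ℝ) (r : Fin n) (α : Fin n → ℝ) :
    Matrix (Fin n) (Fin n) ℝ :=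
  (1 + Q15 A r α) * A

/-- The relation `x ≲ y` relative to the preconditioned matrix `B`: strict inequality, where
equality is also admitted if `B` is irreducible. -/
def LessSim {n : ℕ} (B : Matrix (Fin n) (Fin n) ℝ) (x y : ℝ) : Prop :=
  x < y ∨ (x = y ∧ IsIrreducible B)

end PrecAOR

/-! ### Perron–Frobenius theory for nonnegative matrices, by compactness -/

namespace PrecAOR

open Matrix Finset

variable {ι : Type*} [Fintype ι]

/-! Split `A = M - N` with `M = D - γL`. The AOR matrix is `(1 - ω)I + ω M⁻¹N`, so for nonnegative
splittings its spectral radius is `1 - ω + ωρ`, with `ρ` the Perron value of the pencil `Nx = ρMx`,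
and only `ρ` has to be compared with the value `ρ'` of the preconditioned matrix `A' = (I + Q)A = M'
- N'`.

Take a right vector `x > 0` for `A` and a left vector `w ≥ 0` for `A'`. Since `Ax = (1 - ρ)Mx`, the
residual `z = M'x - (I + Q)Mx` satisfies `N'x = ρM'x + (1 - ρ)z`. Pairing with `w` gives `(ρ' - ρ)
wM'x = (1 - ρ) wz`. Here `wM'x > 0` and `wz < 0`, so `ρ' - ρ` has the sign of `ρ - 1`, which is the
trichotomy (`rho_aor_A15_trichotomy`). The case conditions serve to find an index `i₀ < r` with `z
i₀ < 0` and to ensure `w i₀ > 0`.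

Two points need care. For `γ = 1` the first column of `N` is zero and `M⁻¹N` can be reducible
although `A` is not; irreducibility is therefore used on the pencil (`exists_pencil_eigenvector`).
And when `r` is the last index with all `α k` positive, `A'` may itself be reducible: column `r` can
vanish off the diagonal. Then `A'` is still irreducible on the remaining indices
(`exists_irreducible_support`), and `w` is supported there. -/

theorem mulVec_nonneg {T : Matrix ι ι ℝ} (hT : ∀ i j, 0 ≤ T i j) {x : ι → ℝ}
    (hx : ∀ i, 0 ≤ x i) (i : ι) : 0 ≤ (T *ᵥ x) i :=
  sum_nonneg fun j _ => mul_nonneg (hT i j) (hx j)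

theorem mul_apply_nonneg {X Y : Matrix ι ι ℝ} (hX : ∀ i j, 0 ≤ X i j) (hY : ∀ i j, 0 ≤ Y i j)
    (i j : ι) : 0 ≤ (X * Y) i j := by
  rw [mul_apply]
  exact sum_nonneg fun k _ => mul_nonneg (hX i k) (hY k j)

theorem mulVec_mono {T : Matrix ι ι ℝ} (hT : ∀ i j, 0 ≤ T i j) {x y : ι → ℝ}
    (hxy : ∀ i, x i ≤ y i) (i : ι) : (T *ᵥ x) i ≤ (T *ᵥ y) i :=
  sum_le_sum fun j _ => mul_le_mul_of_nonneg_left (hxy j) (hT i j)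

theorem mulVec_pos {T : Matrix ι ι ℝ} (hT : ∀ i j, 0 < T i j) {x : ι → ℝ}
    (hx : ∀ i, 0 ≤ x i) (hx0 : x ≠ 0) (i : ι) : 0 < (T *ᵥ x) i := by
  obtain ⟨j, hj⟩ := Function.ne_iff.mp hx0
  exact sum_pos' (fun k _ => mul_nonneg (hT i k).le (hx k))
    ⟨j, mem_univ _, mul_pos (hT i j) (lt_of_le_of_ne (hx j) (Ne.symm hj))⟩

theorem sum_mulVec_le {T : Matrix ι ι ℝ} (hT : ∀ i j, 0 ≤ T i j) {x : ι → ℝ}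
    (hx : x ∈ stdSimplex ℝ ι) : ∑ i, (T *ᵥ x) i ≤ ∑ i, ∑ j, T i j := by
  refine sum_le_sum fun i _ => sum_le_sum fun j _ => ?_
  exact mul_le_of_le_one_right (hT i j)
    (hx.2 ▸ single_le_sum (fun k _ => hx.1 k) (mem_univ j))

theorem ne_zero_of_mem_stdSimplex {x : ι → ℝ} (hx : x ∈ stdSimplex ℝ ι) : x ≠ 0 := by
  rintro rfl
  simpa using hx.2

/-- A matrix with positive entries has a nonnegative eigenvector. -/
theorem exists_eigenvector_of_pos [Nonempty ι] {T : Matrix ι ι ℝ} (hT : ∀ i j, 0 < T i j) :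
    ∃ ρ : ℝ, ∃ x ∈ stdSimplex ℝ ι, T *ᵥ x = ρ • x := by
  classical
  have hT0 : ∀ i j, 0 ≤ T i j := fun i j => (hT i j).le
  set B : ℝ := ∑ i, ∑ j, T i j with hB
  have hB0 : 0 ≤ B := sum_nonneg fun i _ => sum_nonneg fun j _ => hT0 i j
  -- Collatz–Wielandt: maximize `ρ` subject to `ρx ≤ Tx` on the simplex. If the optimum is not an
  -- equality, applying `T > 0` makes every inequality strict, and the normalized `Tx` admits a
  -- larger `ρ`.
  let K : Set (ℝ × (ι → ℝ)) :=
    (Set.Icc 0 B ×ˢ stdSimplex ℝ ι) ∩ {p | ∀ i, p.1 * p.2 i ≤ (T *ᵥ p.2) i}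
  have hK : IsCompact K := by
    refine (isCompact_Icc.prod (isCompact_stdSimplex ℝ ι)).inter_right ?_
    simp only [Set.ofPred_forall, mulVec, dotProduct]
    exact isClosed_iInter fun i => isClosed_le (by fun_prop) (by fun_prop)
  have hKne : K.Nonempty := by
    obtain ⟨i⟩ := ‹Nonempty ι›
    have hs := single_mem_stdSimplex ℝ i
    refine ⟨(0, Pi.single i 1), ⟨⟨le_rfl, hB0⟩, hs⟩, fun j => ?_⟩
    simpa using mulVec_nonneg hT0 hs.1 j
  obtain ⟨⟨ρ, x⟩, ⟨⟨hρ, hx⟩, hle⟩, hmax⟩ := hK.exists_isMaxOn hKne continuous_fst.continuousOn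
  refine ⟨ρ, x, hx, ?_⟩
  by_contra hne
  have hy0 : T *ᵥ x - ρ • x ≠ 0 := sub_ne_zero.mpr hne
  have hy : ∀ i, 0 ≤ (T *ᵥ x - ρ • x) i := fun i => by simpa using hle i
  have hTy : ∀ i, ρ * (T *ᵥ x) i < (T *ᵥ (T *ᵥ x)) i := fun i => by
    have := mulVec_pos hT hy hy0 i
    rw [mulVec_sub, mulVec_smul] at this
    simpa using this
  have hTx : ∀ i, 0 < (T *ᵥ x) i := mulVec_pos hT hx.1 (ne_zero_of_mem_stdSimplex hx)
  set s : ℝ := ∑ i, (T *ᵥ x) i with hs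
  have hs0 : 0 < s := sum_pos (fun i _ => hTx i) univ_nonempty
  have hx' : s⁻¹ • (T *ᵥ x) ∈ stdSimplex ℝ ι := by
    refine ⟨fun i => mul_nonneg (inv_nonneg.mpr hs0.le) (hTx i).le, ?_⟩
    simp only [Pi.smul_apply, smul_eq_mul, ← mul_sum]
    exact inv_mul_cancel₀ hs0.ne'
  obtain ⟨i₀, hi₀⟩ := Finite.exists_min fun i => (T *ᵥ (T *ᵥ x)) i / (T *ᵥ x) i
  set ρ' := (T *ᵥ (T *ᵥ x)) i₀ / (T *ᵥ x) i₀ with hρ'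
  have hlt : ρ < ρ' := (lt_div_iff₀ (hTx i₀)).mpr (hTy i₀)
  have hle' : ∀ i, ρ' * (s⁻¹ • (T *ᵥ x)) i ≤ (T *ᵥ (s⁻¹ • (T *ᵥ x))) i := fun i => by
    have := (le_div_iff₀ (hTx i)).mp (hi₀ i)
    rw [mulVec_smul]
    simp only [Pi.smul_apply, smul_eq_mul]
    rw [mul_left_comm]
    exact mul_le_mul_of_nonneg_left this (inv_nonneg.mpr hs0.le)
  have hB' : ρ' ≤ B := by
    have h1 := sum_le_sum fun i (_ : i ∈ univ) => hle' i
    rw [← mul_sum, hx'.2, mul_one] at h1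
    exact h1.trans (sum_mulVec_le hT0 hx')
  have : ρ' ≤ ρ := hmax (show (ρ', s⁻¹ • (T *ᵥ x)) ∈ K from
    ⟨⟨⟨hρ.1.trans hlt.le, hB'⟩, hx'⟩, hle'⟩)
  exact absurd hlt this.not_gt

/-- If `T ≥ 0` and `T u ≥ t u` for some nonzero `u ≥ 0`, then `T` has a nonnegative eigenvector
with eigenvalue at least `t`. -/
theorem exists_eigenvector_of_nonneg {T : Matrix ι ι ℝ} (hT : ∀ i j, 0 ≤ T i j)
    {u : ι → ℝ} (hu : ∀ i, 0 ≤ u i) (hu0 : u ≠ 0) {t : ℝ} (ht : ∀ i, t * u i ≤ (T *ᵥ u) i) :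
    ∃ ρ : ℝ, t ≤ ρ ∧ ∃ x ∈ stdSimplex ℝ ι, T *ᵥ x = ρ • x := by
  classical
  obtain ⟨k₀, hk₀⟩ := Function.ne_iff.mp hu0
  have : Nonempty ι := ⟨k₀⟩
  set B : ℝ := ∑ i, ∑ j, (T i j + 1) with hB
  -- Eigenpairs of the perturbed matrices `T + ε`, all entries raised by `ε`; the perturbation adds
  -- `ε` to each coordinate because `x` sums to 1. Compactness allows `ε → 0`, and the bound `t ≤ ρ`
  -- survives.
  let K : Set (ℝ × ℝ × (ι → ℝ)) := (Set.Icc 0 1 ×ˢ (Set.Icc t B ×ˢ stdSimplex ℝ ι)) ∩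
    {p | ∀ i, (T *ᵥ p.2.2) i + p.1 = p.2.1 * p.2.2 i}
  have hK : IsCompact K := by
    refine (isCompact_Icc.prod (isCompact_Icc.prod (isCompact_stdSimplex ℝ ι))).inter_right ?_
    simp only [Set.ofPred_forall, mulVec, dotProduct]
    exact isClosed_iInter fun i => isClosed_eq (by fun_prop) (by fun_prop)
  have hcl : IsClosed (Prod.fst '' K) := (hK.image continuous_fst).isClosed
  have hsub : Set.Ioc (0 : ℝ) 1 ⊆ Prod.fst '' K := by
    intro ε hε
    have hTε : ∀ i j, 0 < (T + Matrix.of fun _ _ => ε : Matrix ι ι ℝ) i j := fun i j =>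
      add_pos_of_nonneg_of_pos (hT i j) hε.1
    obtain ⟨ρ, x, hx, hxρ⟩ := exists_eigenvector_of_pos hTε
    have heq : ∀ i, (T *ᵥ x) i + ε = ρ * x i := fun i => by
      have := congrFun hxρ i
      rw [add_mulVec] at this
      simp only [Pi.add_apply, mulVec, dotProduct, of_apply, ← mul_sum, hx.2, mul_one,
        Pi.smul_apply, smul_eq_mul] at this
      exact this
    have hρB : ρ ≤ B := by
      have h1 := sum_mulVec_le (fun i j => (hTε i j).le) hx
      rw [hxρ] at h1
      simp only [Pi.smul_apply, smul_eq_mul, ← mul_sum, hx.2, mul_one] at h1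
      exact h1.trans (sum_le_sum fun i _ => sum_le_sum fun j _ => by simpa using hε.2)
    have hxpos : ∀ i, 0 < x i := fun i => by
      have h1 : 0 < ρ * x i := by
        rw [← heq]
        exact add_pos_of_nonneg_of_pos (mulVec_nonneg hT hx.1 i) hε.1
      exact lt_of_le_of_ne (hx.1 i) fun h => by simp [← h] at h1
    -- Scale `x` to the least multiple `c • x` dominating `u`; the two touch at `i`, where `t * u i
    -- ≤ (T u) i ≤ c (T x) i`.
    have htρ : t ≤ ρ := by
      obtain ⟨i, hi, hmin⟩ := exists_max_image univ (fun i => u i / x i) univ_nonempty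
      set c := u i / x i with hc
      have hck : 0 < u k₀ / x k₀ :=
        div_pos (lt_of_le_of_ne (hu k₀) (Ne.symm hk₀)) (hxpos k₀)
      have hc0 : 0 < c := hck.trans_le (hmin k₀ (mem_univ _))
      have hux : ∀ j, u j ≤ (c • x) j := fun j => (div_le_iff₀ (hxpos j)).mp (hmin j (mem_univ _))
      have hui : u i = c * x i := (div_mul_cancel₀ _ (hxpos i).ne').symm
      have h1 := (ht i).trans (mulVec_mono hT hux i)
      rw [mulVec_smul, Pi.smul_apply, smul_eq_mul, hui] at h1
      have h2 : t * x i ≤ (T *ᵥ x) i := by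
        refine le_of_mul_le_mul_left ?_ hc0
        linarith
      have h3 : t * x i ≤ ρ * x i := by linarith [heq i, hε.1]
      exact le_of_mul_le_mul_right h3 (hxpos i)
    exact ⟨(ε, ρ, x), ⟨⟨⟨hε.1.le, hε.2⟩, ⟨htρ, hρB⟩, hx⟩, heq⟩, rfl⟩
  have h0 : (0 : ℝ) ∈ Prod.fst '' K := by
    refine closure_minimal hsub hcl ?_
    rw [closure_Ioc zero_ne_one]
    simp
  obtain ⟨⟨ε, ρ, x⟩, ⟨⟨-, hρ, hx⟩, heq⟩, rfl⟩ := h0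
  exact ⟨ρ, hρ.1, x, hx, funext fun i => by simpa using heq i⟩

/-! ### Perron–Frobenius for pencils -/

variable [DecidableEq ι]

/-- Perron-Frobenius for the pencil `N x = ρ (D - P) x`, where `D - P` has a nonnegative inverse
and `P + N` is irreducible on the set `S` and has zero rows outside of `S`. -/
theorem exists_pencil_eigenvector {d : ι → ℝ} {P N : Matrix ι ι ℝ} {S : Set ι}
    (hd : ∀ i, 0 < d i) (hP : ∀ i j, 0 ≤ P i j) (hN : ∀ i j, 0 ≤ N i j)
    (hdet : IsUnit (diagonal d - P).det) (hinv : ∀ i j, 0 ≤ (diagonal d - P)⁻¹ i j)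
    (hS : S.Nonempty) (hrow : ∀ i ∉ S, ∀ j, P i j = 0 ∧ N i j = 0)
    (hirr : ∀ Z ⊆ S, Z.Nonempty → (∀ i ∈ Z, ∀ j ∈ S, j ∉ Z → P i j = 0 ∧ N i j = 0) → Z = S) :
    ∃ ρ : ℝ, 0 ≤ ρ ∧ ∃ x : ι → ℝ, (∀ i ∈ S, 0 < x i) ∧ (∀ i ∉ S, x i = 0) ∧
      N *ᵥ x = ρ • ((diagonal d - P) *ᵥ x) ∧
      (∀ i, 0 ≤ ((diagonal d - P) *ᵥ x) i) ∧ (diagonal d - P) *ᵥ x ≠ 0 := by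
  classical
  set M := diagonal d - P with hM
  have hMrow : ∀ (v : ι → ℝ) i, d i * v i = (P *ᵥ v) i + (M *ᵥ v) i := fun v i => by
    rw [hM, sub_mulVec, Pi.sub_apply, mulVec_diagonal]; ring
  have hMinv : ∀ v, M *ᵥ (M⁻¹ *ᵥ v) = v := fun v => by
    rw [mulVec_mulVec, mul_nonsing_inv _ hdet, one_mulVec]
  have hMinv' : ∀ v, M⁻¹ *ᵥ (M *ᵥ v) = v := fun v => by
    rw [mulVec_mulVec, nonsing_inv_mul _ hdet, one_mulVec]
  have hterm : ∀ {G : Matrix ι ι ℝ} {v : ι → ℝ}, (∀ i j, 0 ≤ G i j) → (∀ i, 0 ≤ v i) →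
      ∀ i, (G *ᵥ v) i = 0 → ∀ j, 0 < v j → G i j = 0 := fun {G v} hG hv i h j hj => by
    have := (sum_eq_zero_iff_of_nonneg fun k _ => mul_nonneg (hG i k) (hv k)).mp h j (mem_univ _)
    exact (mul_eq_zero.mp this).resolve_right hj.ne'
  have hout : ∀ v : ι → ℝ, ∀ i ∉ S, (M *ᵥ v) i = 0 → v i = 0 := fun v i hi h => by
    have h1 := hMrow v i
    have h2 : (P *ᵥ v) i = 0 := sum_eq_zero fun j _ => mul_eq_zero_of_left (hrow i hi j).1 _
    rw [h, h2, add_zero] at h1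
    exact (mul_eq_zero.mp h1).resolve_left (hd i).ne'
  have hNout : ∀ v : ι → ℝ, ∀ i ∉ S, (N *ᵥ v) i = 0 := fun v i hi =>
    sum_eq_zero fun j _ => mul_eq_zero_of_left (hrow i hi j).2 _
  -- a nonnegative vector whose zero rows are zero rows of the pencil is positive on `S`
  have hpos : ∀ v u : ι → ℝ, (∀ i, 0 ≤ v i) → (∀ i, 0 ≤ u i) → (∀ i ∈ S, 0 < v i → 0 < u i) →
      ∀ ρ : ℝ, 0 < ρ → N *ᵥ u = ρ • (M *ᵥ v) → v ≠ 0 → ∀ i ∈ S, 0 < v i := by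
    intro v u hv hu huv ρ hρ hNM hv0
    have hv_out : ∀ i ∉ S, v i = 0 := fun i hi => hout v i hi <| by
      have h1 := congrFun hNM i
      rw [hNout u i hi, Pi.smul_apply, smul_eq_mul] at h1
      exact (mul_eq_zero.mp h1.symm).resolve_left hρ.ne'
    by_contra! hcon
    obtain ⟨i₀, hi₀, hvi₀⟩ := hcon
    -- In a row where `v` vanishes, `Pv` and `Mv` are nonnegative with sum zero. So no entry of `P`
    -- or `N` links a zero of `v` to a nonzero one inside `S`.
    have hZ : {i | i ∈ S ∧ v i = 0} = S := by
      refine hirr _ (fun i hi => hi.1) ⟨i₀, hi₀, le_antisymm hvi₀ (hv i₀)⟩ ?_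
      rintro i ⟨-, hi⟩ j hjS hj
      have hvj : 0 < v j := lt_of_le_of_ne (hv j) fun h => hj ⟨hjS, h.symm⟩
      have h1 := hMrow v i
      have h2 := congrFun hNM i
      rw [Pi.smul_apply, smul_eq_mul] at h2
      have h3 := mulVec_nonneg hP hv i
      have h4 := mulVec_nonneg hN hu i
      rw [hi, mul_zero] at h1
      have h5 : 0 ≤ (M *ᵥ v) i := nonneg_of_mul_nonneg_right (h2 ▸ h4) hρ
      have h6 : (M *ᵥ v) i = 0 := by linarith
      rw [h6, mul_zero] at h2
      exact ⟨hterm hP hv i (by linarith) j hvj, hterm hN hu i h2 j (huv j hjS hvj)⟩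
    refine hv0 (funext fun i => ?_)
    by_cases hi : i ∈ S
    · rw [← hZ] at hi
      exact hi.2
    · exact hv_out i hi
  set u : ι → ℝ := S.indicator 1 with hu
  have hu0 : ∀ i, 0 ≤ u i := fun i => Set.indicator_nonneg (fun _ _ => zero_le_one) i
  have huS : ∀ i ∈ S, u i = 1 := fun i hi => by simp [hu, hi]
  have huSc : ∀ i ∉ S, u i = 0 := fun i hi => by simp [hu, hi]
  obtain ⟨k₀, hk₀⟩ := hS
  have hune : u ≠ 0 := Function.ne_iff.mpr ⟨k₀, by simp [huS k₀ hk₀]⟩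
  -- If `N` kills the indicator of `S`, the eigenvalue is 0 and `M⁻¹u` serves. Otherwise `M⁻¹Nu` is
  -- positive on `S`; its minimum there is a lower bound making `ρ > 0`, as `hpos` requires.
  by_cases hNu : N *ᵥ u = 0
  · set x := M⁻¹ *ᵥ u with hx
    have hx0 : ∀ i, 0 ≤ x i := mulVec_nonneg hinv hu0
    have hMx : M *ᵥ x = u := hMinv u
    have hxSc : ∀ i ∉ S, x i = 0 := fun i hi => hout x i hi (by rw [hMx, huSc i hi])
    refine ⟨0, le_rfl, x, fun i hi => ?_, hxSc, ?_, fun i => hMx ▸ hu0 i, hMx ▸ hune⟩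
    · have h1 := hMrow x i
      rw [hMx, huS i hi] at h1
      refine pos_of_mul_pos_right (a := d i) ?_ (hd i).le
      linarith [mulVec_nonneg hP hx0 i]
    · rw [zero_smul]
      refine funext fun i => sum_eq_zero fun j _ => ?_
      by_cases hj : j ∈ S
      · exact mul_eq_zero_of_left
          (hterm hN hu0 i (congrFun hNu i) j (by rw [huS j hj]; exact one_pos)) _
      · exact mul_eq_zero_of_right _ (hxSc j hj)
  · set v := M⁻¹ *ᵥ (N *ᵥ u) with hv
    have hv0 : ∀ i, 0 ≤ v i := mulVec_nonneg hinv (mulVec_nonneg hN hu0)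
    have hMv : M *ᵥ v = N *ᵥ u := hMinv _
    have hvpos : ∀ i ∈ S, 0 < v i :=
      hpos v u hv0 hu0 (fun i hi _ => by rw [huS i hi]; exact one_pos) 1 one_pos
        (by rw [one_smul, hMv]) fun h => hNu (by rw [← hMv, h, mulVec_zero])
    obtain ⟨k, hk, hkmin⟩ := exists_min_image (univ.filter (· ∈ S)) v ⟨k₀, by simpa using hk₀⟩
    have hkS : k ∈ S := by simpa using hk
    have hT : ∀ i j, 0 ≤ (M⁻¹ * N) i j := mul_apply_nonneg hinv hN
    obtain ⟨ρ, hρ, x, hx, hxρ⟩ := exists_eigenvector_of_nonneg hT hu0 hune (t := v k) fun i => by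
      rw [← mulVec_mulVec]
      by_cases hi : i ∈ S
      · rw [huS i hi, mul_one]
        exact hkmin i (by simpa using hi)
      · rw [huSc i hi, mul_zero]
        exact hv0 i
    have hρ0 : 0 < ρ := (hvpos k hkS).trans_le hρ
    have hNx : N *ᵥ x = ρ • (M *ᵥ x) := by
      rw [← mulVec_smul, ← hxρ, ← mulVec_mulVec, hMinv]
    have hx0 := ne_zero_of_mem_stdSimplex hx
    refine ⟨ρ, hρ0.le, x, hpos x x hx.1 hx.1 (fun _ _ h => h) ρ hρ0 hNx hx0, fun i hi => ?_, hNx,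
      fun i => ?_, fun h => hx0 (by rw [← hMinv' x, h, mulVec_zero])⟩
    · refine hout x i hi ?_
      have h1 := congrFun hNx i
      rw [hNout x i hi, Pi.smul_apply, smul_eq_mul] at h1
      exact (mul_eq_zero.mp h1.symm).resolve_left hρ0.ne'
    · refine nonneg_of_mul_nonneg_right (a := ρ) ?_ hρ0
      have h1 := congrFun hNx i
      rw [Pi.smul_apply, smul_eq_mul] at h1
      rw [← h1]
      exact mulVec_nonneg hN hx.1 i

end PrecAOR

/-! ### Spectral radius from a nonnegative eigenvector -/

namespace PrecAOR

open Matrix Finset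

variable {n : ℕ}

theorem mem_spectrum_iff_exists_mulVec {ι : Type*} [Fintype ι] [DecidableEq ι] {C : Matrix ι ι ℂ}
    {z : ℂ} : z ∈ spectrum ℂ C ↔ ∃ v ≠ 0, C *ᵥ v = z • v := by
  rw [mem_spectrum_iff_isRoot_charpoly, Polynomial.IsRoot.def, eval_charpoly,
    ← exists_mulVec_eq_zero_iff]
  refine exists_congr fun v => and_congr_right fun _ => ?_
  rw [sub_mulVec, scalar_apply, ← smul_one_eq_diagonal, smul_mulVec, one_mulVec, sub_eq_zero,
    eq_comm]

theorem spectrum_transpose {ι : Type*} [Fintype ι] [DecidableEq ι] (C : Matrix ι ι ℂ) :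
    spectrum ℂ Cᵀ = spectrum ℂ C := by
  ext z
  rw [mem_spectrum_iff_isRoot_charpoly, mem_spectrum_iff_isRoot_charpoly, charpoly_transpose]

theorem rho_transpose (T : Matrix (Fin n) (Fin n) ℝ) : rho Tᵀ = rho T := by
  rw [rho, rho, spectralRadius, spectralRadius, transpose_map, spectrum_transpose]

theorem rho_mul_comm (X Y : Matrix (Fin n) (Fin n) ℝ) : rho (X * Y) = rho (Y * X) := by
  have hmap : ∀ X Y : Matrix (Fin n) (Fin n) ℝ, (X * Y).map ((↑) : ℝ → ℂ) =
      X.map ((↑) : ℝ → ℂ) * Y.map ((↑) : ℝ → ℂ) := fun X Y =>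
    Matrix.map_mul (f := Complex.ofRealHom)
  have hs : spectrum ℂ ((X * Y).map ((↑) : ℝ → ℂ)) = spectrum ℂ ((Y * X).map ((↑) : ℝ → ℂ)) := by
    ext z
    rw [mem_spectrum_iff_isRoot_charpoly, mem_spectrum_iff_isRoot_charpoly, hmap, hmap,
      charpoly_mul_comm]
  rw [rho, rho, spectralRadius, spectralRadius, hs]

/-- A nonnegative left eigenvector of a nonnegative matrix determines the spectral radius, if the
columns at which the vector vanishes are trivial. -/
theorem rho_eq_of_vecMul_eq {T : Matrix (Fin n) (Fin n) ℝ} (hT : ∀ i j, 0 ≤ T i j) {ρ : ℝ}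
    (hρ : 0 ≤ ρ) {w : Fin n → ℝ} (hw : ∀ i, 0 ≤ w i) (hw0 : w ≠ 0) (hwT : w ᵥ* T = ρ • w)
    (hcol : ∀ j, w j = 0 → T j j ≤ ρ ∧ ∀ i, i ≠ j → T i j = 0) :
    rho T = ENNReal.ofReal ρ := by
  have hnorm : (‖(ρ : ℂ)‖₊ : ℝ≥0∞) = ENNReal.ofReal ρ := by
    rw [ENNReal.ofReal, ← norm_toNNReal, Complex.norm_of_nonneg hρ]
  apply le_antisymm
  · refine iSup₂_le fun z hz => ?_
    obtain ⟨v, hv0, hv⟩ := mem_spectrum_iff_exists_mulVec.mp hz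
    have hvi : ∀ i, ∑ j, (T i j : ℂ) * v j = z * v i := fun i => congrFun hv i
    suffices h : ‖z‖ ≤ ρ by
      rw [ENNReal.ofReal, ← norm_toNNReal]
      exact ENNReal.coe_le_coe.mpr (Real.toNNReal_le_toNNReal h)
    -- If the supports meet, the `w`-weighted sum of `‖v i‖` is positive and bounds `‖z‖`. If not,
    -- `v` only sees columns that are diagonal, so `z` is a diagonal entry.
    by_cases hsupp : ∃ j, w j ≠ 0 ∧ v j ≠ 0
    · obtain ⟨j₀, hwj, hvj⟩ := hsupp
      have hpos : 0 < ∑ i, w i * ‖v i‖ :=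
        sum_pos' (fun i _ => mul_nonneg (hw i) (norm_nonneg _)) ⟨j₀, mem_univ _,
          mul_pos (lt_of_le_of_ne (hw j₀) (Ne.symm hwj)) (norm_pos_iff.mpr hvj)⟩
      refine le_of_mul_le_mul_right ?_ hpos
      calc ‖z‖ * ∑ i, w i * ‖v i‖ = ∑ i, w i * ‖z * v i‖ := by
            rw [mul_sum]
            exact sum_congr rfl fun i _ => by rw [norm_mul]; ring
        _ ≤ ∑ i, w i * ∑ j, T i j * ‖v j‖ := by
            refine sum_le_sum fun i _ => mul_le_mul_of_nonneg_left ?_ (hw i)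
            rw [← hvi]
            refine (norm_sum_le _ _).trans (sum_le_sum fun j _ => ?_)
            rw [norm_mul, Complex.norm_of_nonneg (hT i j)]
        _ = ∑ j, (∑ i, w i * T i j) * ‖v j‖ := by
            simp_rw [mul_sum, sum_mul]
            rw [sum_comm]
            exact sum_congr rfl fun j _ => sum_congr rfl fun i _ => by ring
        _ = ρ * ∑ j, w j * ‖v j‖ := by
            rw [mul_sum]
            refine sum_congr rfl fun j _ => ?_
            have h1 : ∑ i, w i * T i j = ρ * w j := congrFun hwT j
            rw [h1, mul_assoc]
    · push Not at hsupp
      obtain ⟨j, hvj⟩ := Function.ne_iff.mp hv0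
      have hwv : ∀ k, v k ≠ 0 → w k = 0 := fun k hk => by
        by_contra h
        exact hk (hsupp k h)
      have h1 : (T j j : ℂ) * v j = z * v j := by
        rw [← hvi j]
        symm
        refine Fintype.sum_eq_single (f := fun k => (T j k : ℂ) * v k) j fun k hk => ?_
        by_cases hvk : v k = 0
        · simp only [hvk, mul_zero]
        · simp only [(hcol k (hwv k hvk)).2 j hk.symm, Complex.ofReal_zero, zero_mul]
      have h2 : z = T j j := (mul_right_cancel₀ hvj h1).symm
      rw [h2, Complex.norm_of_nonneg (hT j j)]
      exact (hcol j (hwv j hvj)).1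
  · rw [← hnorm]
    refine le_iSup₂_of_le (f := fun (k : ℂ) (_ : k ∈ spectrum ℂ (T.map ((↑) : ℝ → ℂ))) =>
      (‖k‖₊ : ℝ≥0∞)) (ρ : ℂ) ?_ le_rfl
    rw [← spectrum_transpose, mem_spectrum_iff_exists_mulVec]
    obtain ⟨j, hj⟩ := Function.ne_iff.mp hw0
    refine ⟨fun i => (w i : ℂ), Function.ne_iff.mpr ⟨j, by simpa using hj⟩, ?_⟩
    rw [mulVec_transpose]
    funext i
    have h1 : ∑ k, w k * T k i = ρ * w i := congrFun hwT i
    have h2 : ∑ k, (w k : ℂ) * (T k i : ℂ) = ρ * w i := by exact_mod_cast h1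
    exact h2

theorem rho_eq_of_mulVec_eq {T : Matrix (Fin n) (Fin n) ℝ} (hT : ∀ i j, 0 ≤ T i j) {ρ : ℝ}
    (hρ : 0 ≤ ρ) {x : Fin n → ℝ} (hx : ∀ i, 0 < x i) (hx0 : x ≠ 0) (hTx : T *ᵥ x = ρ • x) :
    rho T = ENNReal.ofReal ρ := by
  rw [← rho_transpose]
  exact rho_eq_of_vecMul_eq (T := Tᵀ) (fun i j => hT j i) hρ (fun i => (hx i).le) hx0
    (by rw [vecMul_transpose, hTx]) fun j hj => absurd hj (hx j).ne'

end PrecAOR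

/-! ### The splitting behind AOR and its Perron vectors -/

namespace PrecAOR

open Matrix Finset

variable {n : ℕ}

/-- The matrices of the splitting `B = M - N` with `M = D - γ L`. -/
def splitM (γ : ℝ) (B : Matrix (Fin n) (Fin n) ℝ) : Matrix (Fin n) (Fin n) ℝ :=
  diagPart B - γ • lowerPart B

def splitN (γ : ℝ) (B : Matrix (Fin n) (Fin n) ℝ) : Matrix (Fin n) (Fin n) ℝ :=
  (1 - γ) • lowerPart B + upperPart B

/-- The factor by which the entries of `B` are multiplied in `splitM γ B`. -/
def splitCoeff (γ : ℝ) (i j : Fin n) : ℝ :=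
  if i = j then 1 else if j < i then γ else 0

theorem splitCoeff_nonneg {γ : ℝ} (hγ : 0 ≤ γ) (i j : Fin n) : 0 ≤ splitCoeff γ i j := by
  unfold splitCoeff
  split_ifs <;> simp [hγ]

theorem splitCoeff_le_one {γ : ℝ} (hγ : γ ≤ 1) (i j : Fin n) : splitCoeff γ i j ≤ 1 := by
  unfold splitCoeff
  split_ifs <;> simp [hγ]

theorem splitCoeff_of_lt {γ : ℝ} {i j : Fin n} (h : i < j) : splitCoeff γ i j = 0 := by
  rw [splitCoeff, if_neg h.ne, if_neg h.not_gt]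

theorem splitM_apply (γ : ℝ) (B : Matrix (Fin n) (Fin n) ℝ) (i j : Fin n) :
    splitM γ B i j = splitCoeff γ i j * B i j := by
  rcases lt_trichotomy i j with h | rfl | h
  · simp [splitM, splitCoeff, diagPart, lowerPart, h.ne, h.not_gt]
  · simp [splitM, splitCoeff, diagPart, lowerPart]
  · simp [splitM, splitCoeff, diagPart, lowerPart, h.ne', h]

theorem splitN_apply (γ : ℝ) (B : Matrix (Fin n) (Fin n) ℝ) (i j : Fin n) :
    splitN γ B i j = (1 - splitCoeff γ i j) * -B i j := by
  rcases lt_trichotomy i j with h | rfl | h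
  · simp [splitN, splitCoeff, upperPart, lowerPart, h.ne, h.not_gt, h]
  · simp [splitN, splitCoeff, upperPart, lowerPart]
  · simp [splitN, splitCoeff, upperPart, lowerPart, h.ne', h, h.not_gt]

theorem splitM_sub_splitN (γ : ℝ) (B : Matrix (Fin n) (Fin n) ℝ) :
    splitM γ B - splitN γ B = B := by
  ext i j
  rw [Matrix.sub_apply, splitM_apply, splitN_apply]
  ring

theorem aor_numerator (γ ω : ℝ) (B : Matrix (Fin n) (Fin n) ℝ) :
    (1 - ω) • diagPart B + (ω - γ) • lowerPart B + ω • upperPart B =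
      (1 - ω) • splitM γ B + ω • splitN γ B := by
  rw [splitM, splitN]
  module

theorem lowerPart_nonneg {B : Matrix (Fin n) (Fin n) ℝ} (hB : IsLMatrix B) (i j : Fin n) :
    0 ≤ lowerPart B i j := by
  simp only [lowerPart, of_apply]
  split_ifs with h
  · exact neg_nonneg.mpr (hB.1 i j h.ne')
  · exact le_rfl

theorem splitN_nonneg {γ : ℝ} (hγ : γ ≤ 1) {B : Matrix (Fin n) (Fin n) ℝ} (hB : IsLMatrix B)
    (i j : Fin n) : 0 ≤ splitN γ B i j := by
  rw [splitN_apply]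
  by_cases h : i = j
  · simp [splitCoeff, h]
  · exact mul_nonneg (sub_nonneg.mpr (splitCoeff_le_one hγ i j)) (neg_nonneg.mpr (hB.1 i j h))

theorem isUnit_det_splitM (γ : ℝ) {B : Matrix (Fin n) (Fin n) ℝ} (hB : IsLMatrix B) :
    IsUnit (splitM γ B).det := by
  have h : (splitM γ B).det = ∏ i, splitM γ B i i := by
    refine det_of_isLowerTriangular _ fun i j hij => ?_
    rw [splitM_apply, splitCoeff_of_lt (OrderDual.toDual_lt_toDual.mp hij), zero_mul]
  rw [h, isUnit_iff_ne_zero]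
  refine prod_ne_zero_iff.mpr fun i _ => ?_
  rw [splitM_apply, splitCoeff, if_pos rfl, one_mul]
  exact (hB.2 i).ne'

/-- Forward substitution: `M` is lower triangular with positive diagonal and nonpositive entries
below it. -/
theorem nonneg_of_splitM_mulVec_nonneg {γ : ℝ} (hγ : 0 ≤ γ) {B : Matrix (Fin n) (Fin n) ℝ}
    (hB : IsLMatrix B) {v : Fin n → ℝ} (hv : ∀ i, 0 ≤ (splitM γ B *ᵥ v) i) (i : Fin n) :
    0 ≤ v i := by
  induction i using WellFoundedLT.induction with
  | _ i ih =>
    have h1 : (splitM γ B *ᵥ v) i = B i i * v i - γ * ∑ j, lowerPart B i j * v j := by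
      rw [splitM, sub_mulVec, Pi.sub_apply, diagPart, mulVec_diagonal, smul_mulVec]
      rfl
    have h2 : 0 ≤ ∑ j, lowerPart B i j * v j := by
      refine sum_nonneg fun j _ => ?_
      by_cases hj : j < i
      · exact mul_nonneg (lowerPart_nonneg hB i j) (ih j hj)
      · simp [lowerPart, hj]
    have h3 := mul_nonneg hγ h2
    refine nonneg_of_mul_nonneg_right (a := B i i) ?_ (hB.2 i)
    linarith [hv i]

theorem splitM_inv_nonneg {γ : ℝ} (hγ : 0 ≤ γ) {B : Matrix (Fin n) (Fin n) ℝ}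
    (hB : IsLMatrix B) (i j : Fin n) : 0 ≤ (splitM γ B)⁻¹ i j := by
  have h := nonneg_of_splitM_mulVec_nonneg hγ hB (v := (splitM γ B)⁻¹ *ᵥ Pi.single j 1)
    (fun k => by
      rw [mulVec_mulVec, mul_nonsing_inv _ (isUnit_det_splitM γ hB), one_mulVec]
      by_cases hk : k = j <;> simp [hk]) i
  rwa [mulVec_single_one] at h

/-- Irreducibility in terms of index sets. -/
theorem IsIrreducible.exists_ne_zero {B : Matrix (Fin n) (Fin n) ℝ} (hB : IsIrreducible B)
    {Y : Set (Fin n)} (hY : Y.Nonempty) (hYc : Yᶜ.Nonempty) : ∃ i ∈ Y, ∃ j ∉ Y, B i j ≠ 0 := by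
  classical
  by_contra! hcon
  refine hB ?_
  -- The permutation lists the complement of `Y` first, so that the rows in `Y` form the zero block.
  set m := Fintype.card {i // i ∉ Y} with hm
  have hmn : m < n := by
    obtain ⟨i, hi⟩ := hY
    have h := Fintype.card_subtype_lt (p := fun i => i ∉ Y) (x := i) (by simpa using hi)
    rwa [Fintype.card_fin] at h
  have e : {i : Fin n // (i : ℕ) < m} ≃ {i // i ∉ Y} :=
    Fintype.equivOfCardEq (Fintype.card_fin_lt_of_le hmn.le)
  refine ⟨e.extendSubtype, m, ?_, hmn, fun i j hi hj => ?_⟩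
  · obtain ⟨i, hi⟩ := hYc
    exact Fintype.card_pos_iff.mpr ⟨⟨i, hi⟩⟩
  · exact hcon _ (by simpa using e.extendSubtype_not_mem i hi.not_gt) _
      (e.extendSubtype_mem j hj)

theorem splitM_eq (γ : ℝ) (B : Matrix (Fin n) (Fin n) ℝ) :
    splitM γ B = diagonal (fun i => B i i) - γ • lowerPart B := rfl

theorem eq_zero_of_split_eq_zero {γ : ℝ} {B : Matrix (Fin n) (Fin n) ℝ} {i j : Fin n}
    (hij : i ≠ j) (hP : (γ • lowerPart B) i j = 0) (hN : splitN γ B i j = 0) : B i j = 0 := by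
  have h1 : splitM γ B i j = 0 := by
    rw [splitM_eq, Matrix.sub_apply, hP, diagonal_apply_ne _ hij, sub_zero]
  rw [← splitM_sub_splitN γ B, Matrix.sub_apply, h1, hN, sub_zero]

theorem split_eq_zero {γ : ℝ} {B : Matrix (Fin n) (Fin n) ℝ} {i j : Fin n}
    (h : i ≠ j → B i j = 0) : (γ • lowerPart B) i j = 0 ∧ splitN γ B i j = 0 := by
  by_cases hij : i = j
  · simp [lowerPart, splitN_apply, splitCoeff, hij]
  · simp [lowerPart, splitN_apply, h hij]

theorem exists_right_eigenvector {γ : ℝ} (hγ0 : 0 ≤ γ) (hγ1 : γ ≤ 1) [Nonempty (Fin n)]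
    {B : Matrix (Fin n) (Fin n) ℝ} (hB : IsLMatrix B) (hirr : IsIrreducible B) :
    ∃ ρ : ℝ, 0 ≤ ρ ∧ ∃ x : Fin n → ℝ, (∀ i, 0 < x i) ∧
      splitN γ B *ᵥ x = ρ • (splitM γ B *ᵥ x) ∧ ∀ i, 0 ≤ (splitM γ B *ᵥ x) i := by
  obtain ⟨ρ, hρ, x, hx, -, hNx, hMx, -⟩ := exists_pencil_eigenvector (d := fun i => B i i)
    (P := γ • lowerPart B) (N := splitN γ B) (S := Set.univ) hB.2
    (fun i j => mul_nonneg hγ0 (lowerPart_nonneg hB i j)) (splitN_nonneg hγ1 hB)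
    (isUnit_det_splitM γ hB) (splitM_inv_nonneg hγ0 hB) Set.univ_nonempty (by simp) (by
      intro Z _ hZ hzero
      by_contra hne
      obtain ⟨i, hi, j, hj, hij⟩ := hirr.exists_ne_zero hZ (Set.nonempty_compl.mpr hne)
      have h := hzero i hi j (Set.mem_univ _) hj
      exact hij (eq_zero_of_split_eq_zero (fun h => hj (h ▸ hi)) h.1 h.2))
  exact ⟨ρ, hρ, x, fun i => hx i (Set.mem_univ _), hNx, hMx⟩

/-- A left eigenvector of the pencil, for a matrix that is irreducible on `S` and whose columns
outside of `S` are diagonal. -/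
theorem exists_left_eigenvector {γ : ℝ} (hγ0 : 0 ≤ γ) (hγ1 : γ ≤ 1)
    {B : Matrix (Fin n) (Fin n) ℝ} (hB : IsLMatrix B) {S : Set (Fin n)} (hS : S.Nonempty)
    (hcol : ∀ j ∉ S, ∀ i, i ≠ j → B i j = 0)
    (hirr : ∀ Y ⊆ S, Y.Nonempty → (S \ Y).Nonempty → ∃ i ∈ Y, ∃ j ∈ S \ Y, B i j ≠ 0) :
    ∃ ρ : ℝ, 0 ≤ ρ ∧ ∃ w : Fin n → ℝ, (∀ i ∈ S, 0 < w i) ∧ (∀ i ∉ S, w i = 0) ∧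
      w ᵥ* splitN γ B = ρ • (w ᵥ* splitM γ B) ∧ (∀ i, 0 ≤ (w ᵥ* splitM γ B) i) ∧
      w ᵥ* splitM γ B ≠ 0 := by
  have hMt : diagonal (fun i => B i i) - (γ • lowerPart B)ᵀ = (splitM γ B)ᵀ := by
    rw [splitM_eq, transpose_sub, diagonal_transpose]
  have := exists_pencil_eigenvector (d := fun i => B i i)
    (P := (γ • lowerPart B)ᵀ) (N := (splitN γ B)ᵀ) (S := S) hB.2
    (fun i j => mul_nonneg hγ0 (lowerPart_nonneg hB j i)) (fun i j => splitN_nonneg hγ1 hB j i)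
    (by rw [hMt, det_transpose]; exact isUnit_det_splitM γ hB)
    (fun i j => by rw [hMt, ← transpose_nonsing_inv]; exact splitM_inv_nonneg hγ0 hB j i) hS
    (fun i hi j => split_eq_zero (hcol i hi j)) (by
      intro Z hZS hZ hzero
      by_contra hne
      -- Transposition reverses the links, so the set closed for the transposed pencil is tested
      -- through its complement in `S`.
      obtain ⟨i, hi, j, hj, hij⟩ := hirr (S \ Z) Set.sdiff_subset
        (Set.nonempty_of_ssubset (hZS.ssubset_of_ne hne))
        (by rwa [Set.sdiff_sdiff_cancel_left hZS])
      rw [Set.sdiff_sdiff_cancel_left hZS] at hj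
      have h := hzero j hj i hi.1 hi.2
      exact hij (eq_zero_of_split_eq_zero (fun h => hi.2 (h ▸ hj)) h.1 h.2))
  simpa only [hMt, mulVec_transpose] using this

theorem rho_aor_of_right {γ ω : ℝ} (hγ0 : 0 ≤ γ) (hγ1 : γ ≤ 1) (hω0 : 0 < ω) (hω1 : ω ≤ 1)
    [Nonempty (Fin n)] {B : Matrix (Fin n) (Fin n) ℝ} (hB : IsLMatrix B) {ρ : ℝ} (hρ : 0 ≤ ρ)
    {x : Fin n → ℝ} (hx : ∀ i, 0 < x i) (hNx : splitN γ B *ᵥ x = ρ • (splitM γ B *ᵥ x)) :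
    rho (aor γ ω B) = ENNReal.ofReal (1 - ω + ω * ρ) := by
  have hdet := isUnit_det_splitM γ hB
  have haor : aor γ ω B = (1 - ω) • 1 + ω • ((splitM γ B)⁻¹ * splitN γ B) := by
    rw [aor, aor_numerator, ← splitM, mul_add, mul_smul_comm, mul_smul_comm,
      nonsing_inv_mul _ hdet]
  have hω : 0 ≤ 1 - ω := sub_nonneg.mpr hω1
  rw [haor]
  refine rho_eq_of_mulVec_eq (fun i j => ?_) (by positivity) hx
    (fun h => (hx (Classical.arbitrary _)).ne' (congrFun h _)) ?_
  · refine add_nonneg (mul_nonneg hω ?_) (mul_nonneg hω0.le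
      (mul_apply_nonneg (splitM_inv_nonneg hγ0 hB) (splitN_nonneg hγ1 hB) i j))
    rw [one_apply]
    split_ifs <;> simp
  · rw [add_mulVec, smul_mulVec, one_mulVec, smul_mulVec, ← mulVec_mulVec, hNx, mulVec_smul,
      mulVec_mulVec, nonsing_inv_mul _ hdet, one_mulVec]
    module

/-- Passing to `N M⁻¹` makes `w` itself the left eigenvector, so its zero set is known; the left
eigenvector of `M⁻¹N` would be `wM`, which can vanish at indices where `w` is positive. -/
theorem rho_aor_of_left {γ ω : ℝ} (hγ0 : 0 ≤ γ) (hγ1 : γ ≤ 1) (hω0 : 0 < ω) (hω1 : ω ≤ 1)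
    {B : Matrix (Fin n) (Fin n) ℝ} (hB : IsLMatrix B) {ρ : ℝ} (hρ : 0 ≤ ρ)
    {w : Fin n → ℝ} (hw : ∀ i, 0 ≤ w i) (hw0 : w ≠ 0)
    (hNw : w ᵥ* splitN γ B = ρ • (w ᵥ* splitM γ B))
    (hcol : ∀ j, w j = 0 → ∀ i, i ≠ j → B i j = 0) :
    rho (aor γ ω B) = ENNReal.ofReal (1 - ω + ω * ρ) := by
  have hdet := isUnit_det_splitM γ hB
  have haor : rho (aor γ ω B) = rho ((1 - ω) • 1 + ω • (splitN γ B * (splitM γ B)⁻¹)) := by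
    rw [aor, aor_numerator, ← splitM, rho_mul_comm, add_mul, smul_mul_assoc, smul_mul_assoc,
      mul_nonsing_inv _ hdet]
  have hω : 0 ≤ 1 - ω := sub_nonneg.mpr hω1
  -- At such `j` the basis vector `e_j` is an eigenvector of `M` and is killed by `N`.
  have hK : ∀ j, w j = 0 → ∀ i, (splitN γ B * (splitM γ B)⁻¹) i j = 0 := fun j hj i => by
    have h1 : splitM γ B *ᵥ Pi.single j 1 = B j j • Pi.single j 1 := by
      rw [mulVec_single_one]
      funext k
      by_cases hk : k = j
      · subst hk
        simp [splitM_apply, splitCoeff]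
      · simp [splitM_apply, hcol j hj k hk, hk]
    have h2 : (splitM γ B)⁻¹ *ᵥ Pi.single j 1 = (B j j)⁻¹ • Pi.single j 1 := by
      rw [eq_inv_smul_iff₀ (hB.2 j).ne', ← mulVec_smul, ← h1, mulVec_mulVec,
        nonsing_inv_mul _ hdet, one_mulVec]
    have h3 : (splitN γ B * (splitM γ B)⁻¹) *ᵥ Pi.single j 1 = 0 := by
      rw [← mulVec_mulVec, h2, mulVec_smul, mulVec_single_one]
      funext k
      simp [(split_eq_zero (γ := γ) (hcol j hj k)).2]
    rw [mulVec_single_one] at h3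
    exact congrFun h3 i
  rw [haor]
  refine rho_eq_of_vecMul_eq (fun i j => ?_) (by positivity) hw hw0 ?_ fun j hj => ⟨?_, ?_⟩
  · refine add_nonneg (mul_nonneg hω ?_) (mul_nonneg hω0.le
      (mul_apply_nonneg (splitN_nonneg hγ1 hB) (splitM_inv_nonneg hγ0 hB) i j))
    rw [one_apply]
    split_ifs <;> simp
  · rw [vecMul_add, vecMul_smul, vecMul_one, vecMul_smul, ← vecMul_vecMul, hNw, smul_vecMul,
      vecMul_vecMul, mul_nonsing_inv _ hdet, vecMul_one]
    module
  · simp only [Matrix.add_apply, Matrix.smul_apply, hK j hj j, one_apply_eq, smul_eq_mul, mul_one, mul_zero]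
    nlinarith
  · intro i hi
    simp [hK j hj i, one_apply_ne hi]

end PrecAOR

/-! ### The preconditioned matrix and the comparison -/

namespace PrecAOR

open Matrix Finset

variable {n : ℕ}

/-- The entry of `Q15 A r α` in row `i` and column `r`. -/
def precCoeff (A : Matrix (Fin n) (Fin n) ℝ) (r : Fin n) (α : Fin n → ℝ) (i : Fin n) : ℝ :=
  if i < r then -(α i * A i r) else 0

theorem one_add_Q15_mul_apply (A X : Matrix (Fin n) (Fin n) ℝ) (r : Fin n) (α : Fin n → ℝ)
    (i j : Fin n) :
    ((1 + Q15 A r α) * X) i j = X i j + precCoeff A r α i * X r j := by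
  have h : (Q15 A r α * X) i j = precCoeff A r α i * X r j := by
    rw [mul_apply, sum_eq_single r]
    · simp [Q15, precCoeff]
    · intro k _ hk
      simp [Q15, hk]
    · simp
  rw [add_mul, one_mul, Matrix.add_apply, h]

theorem A15_apply (A : Matrix (Fin n) (Fin n) ℝ) (r : Fin n) (α : Fin n → ℝ) (i j : Fin n) :
    A15 A r α i j = A i j + precCoeff A r α i * A r j :=
  one_add_Q15_mul_apply A A r α i j

variable {A : Matrix (Fin n) (Fin n) ℝ} {r : Fin n} {α : Fin n → ℝ}

theorem precCoeff_of_le {i : Fin n} (h : r ≤ i) : precCoeff A r α i = 0 := by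
  rw [precCoeff, if_neg h.not_gt]

theorem precCoeff_nonneg (hA : IsLMatrix A) (hα0 : ∀ k, k < r → 0 ≤ α k) (i : Fin n) :
    0 ≤ precCoeff A r α i := by
  unfold precCoeff
  split_ifs with h
  · exact neg_nonneg.mpr (mul_nonpos_of_nonneg_of_nonpos (hα0 i h) (hA.1 i r h.ne))
  · exact le_rfl

theorem A15_apply_of_le {i : Fin n} (h : r ≤ i) (j : Fin n) : A15 A r α i j = A i j := by
  rw [A15_apply, precCoeff_of_le h, zero_mul, add_zero]

theorem A15_apply_col (hAdiag : ∀ i, A i i = 1) {i : Fin n} (h : i < r) :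
    A15 A r α i r = (1 - α i) * A i r := by
  rw [A15_apply, precCoeff, if_pos h, hAdiag]
  ring

theorem A15_apply_le (hA : IsLMatrix A) (hα0 : ∀ k, k < r → 0 ≤ α k) {i j : Fin n}
    (hj : j ≠ r) : A15 A r α i j ≤ A i j := by
  rw [A15_apply]
  linarith [mul_nonpos_of_nonneg_of_nonpos (precCoeff_nonneg hA hα0 i) (hA.1 r j hj.symm)]

theorem isLMatrix_A15 (hA : IsLMatrix A) (hAdiag : ∀ i, A i i = 1)
    (hα0 : ∀ k, k < r → 0 ≤ α k) (hα1 : ∀ k, k < r → α k ≤ 1)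
    (hα : ∀ k, k < r → α k * A k r * A r k < 1) : IsLMatrix (A15 A r α) := by
  refine ⟨fun i j hij => ?_, fun i => ?_⟩
  · by_cases hj : j = r
    · subst hj
      rcases lt_or_ge i j with h | h
      · rw [A15_apply_col hAdiag h]
        exact mul_nonpos_of_nonneg_of_nonpos (sub_nonneg.mpr (hα1 i h)) (hA.1 i j hij)
      · rw [A15_apply_of_le h]
        exact hA.1 i j hij
    · exact (A15_apply_le hA hα0 hj).trans (hA.1 i j hij)
  · rcases lt_or_ge i r with h | h
    · rw [A15_apply, precCoeff, if_pos h, hAdiag]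
      linarith [hα i h]
    · rw [A15_apply_of_le h]
      exact hA.2 i

/-- The residual of the preconditioned splitting at `x`. -/
theorem splitM_A15_mulVec_apply (γ : ℝ) (x : Fin n → ℝ) (i : Fin n) :
    (splitM γ (A15 A r α) *ᵥ x) i - (((1 + Q15 A r α) * splitM γ A) *ᵥ x) i =
      precCoeff A r α i *
        (∑ j, splitCoeff γ i j * A r j * x j - (splitM γ A *ᵥ x) r) := by
  simp only [mulVec, dotProduct]
  rw [← sum_sub_distrib, ← sum_sub_distrib, mul_sum]
  refine sum_congr rfl fun j _ => ?_
  rw [one_add_Q15_mul_apply, splitM_apply, splitM_apply, splitM_apply, A15_apply]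
  ring

/-- The comparison of the spectral radii, for a preconditioned matrix that is irreducible on a set
`S` of indices containing `0, …, r - 1` and has diagonal columns outside of `S`. -/
theorem rho_aor_A15_trichotomy (hA : IsLMatrix A) (hirrA : IsIrreducible A)
    (hA' : IsLMatrix (A15 A r α)) {γ ω : ℝ} (hω0 : 0 < ω) (hω1 : ω ≤ 1) (hγ0 : 0 ≤ γ)
    (hγ1 : γ ≤ 1) (hα0 : ∀ k, k < r → 0 ≤ α k)
    {i₀ j₀ : Fin n} (hi₀ : i₀ < r) (hc : α i₀ * A i₀ r < 0) (hj₀ : A r j₀ < 0) (hj₀r : j₀ ≠ r)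
    (hij : γ < 1 ∨ j₀ ≤ i₀ ∨ r < j₀)
    {S : Set (Fin n)} (hS : ∀ i, i < r → i ∈ S)
    (hcol : ∀ j ∉ S, ∀ i, i ≠ j → A15 A r α i j = 0)
    (hirr : ∀ Y ⊆ S, Y.Nonempty → (S \ Y).Nonempty → ∃ i ∈ Y, ∃ j ∈ S \ Y, A15 A r α i j ≠ 0) :
    (rho (aor γ ω (A15 A r α)) < rho (aor γ ω A) ∧ rho (aor γ ω A) < 1) ∨
    (rho (aor γ ω (A15 A r α)) = rho (aor γ ω A) ∧ rho (aor γ ω A) = 1) ∨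
    (rho (aor γ ω (A15 A r α)) > rho (aor γ ω A) ∧ rho (aor γ ω A) > 1) := by
  have : Nonempty (Fin n) := ⟨r⟩
  obtain ⟨ρ, hρ, x, hx, hNx, hMx⟩ := exists_right_eigenvector hγ0 hγ1 hA hirrA
  obtain ⟨ρ', hρ', w, hw, hwS, hNw, hMw, hMw0⟩ :=
    exists_left_eigenvector hγ0 hγ1 hA' ⟨i₀, hS i₀ hi₀⟩ hcol hirr
  have hw_nonneg : ∀ i, 0 ≤ w i := fun i => by
    by_cases hi : i ∈ S
    · exact (hw i hi).le
    · exact (hwS i hi).ge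
  have hw0 : w ≠ 0 := fun h => (hw i₀ (hS i₀ hi₀)).ne' (congrFun h i₀)
  rw [rho_aor_of_right hγ0 hγ1 hω0 hω1 hA hρ hx hNx,
    rho_aor_of_left hγ0 hγ1 hω0 hω1 hA' hρ' hw_nonneg hw0 hNw
      fun j hj => hcol j fun h => (hw j h).ne' hj]
  set z : Fin n → ℝ :=
    splitM γ (A15 A r α) *ᵥ x - ((1 + Q15 A r α) * splitM γ A) *ᵥ x with hz
  have hzi : ∀ i, z i = precCoeff A r α i *
      (∑ j, splitCoeff γ i j * A r j * x j - (splitM γ A *ᵥ x) r) :=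
    splitM_A15_mulVec_apply γ x
  -- For `i < r` the coefficient removes every column beyond `i`, in particular `r`, where row `r`
  -- has its only positive entry.
  have hterm : ∀ i, i < r → ∀ j, splitCoeff γ i j * A r j * x j ≤ 0 := fun i hi j => by
    rcases le_or_gt j i with h | h
    · exact mul_nonpos_of_nonpos_of_nonneg (mul_nonpos_of_nonneg_of_nonpos
        (splitCoeff_nonneg hγ0 i j) (hA.1 r j (h.trans_lt hi).ne')) (hx j).le
    · rw [splitCoeff_of_lt h, zero_mul, zero_mul]
  have hz0 : ∀ i, z i ≤ 0 := fun i => by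
    rw [hzi]
    rcases lt_or_ge i r with h | h
    · refine mul_nonpos_of_nonneg_of_nonpos (precCoeff_nonneg hA hα0 i) ?_
      linarith [sum_nonpos fun j (_ : j ∈ univ) => hterm i h j, hMx r]
    · rw [precCoeff_of_le h, zero_mul]
  have hzneg : z i₀ < 0 := by
    rw [hzi]
    refine mul_neg_of_pos_of_neg (by rw [precCoeff, if_pos hi₀]; linarith) ?_
    -- Two sources of strictness: if `A r j₀` enters `N`, then `(Nx) r = ρ (Mx) r` forces `(Mx) r >
    -- 0`. If not, then `γ = 1` and `j₀ < r`, so `j₀ ≤ i₀` and the `j₀` term of the sum is negative.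
    by_cases hN : 0 < splitN γ A r j₀
    · have h1 : 0 < (splitN γ A *ᵥ x) r :=
        sum_pos' (fun j _ => mul_nonneg (splitN_nonneg hγ1 hA r j) (hx j).le)
          ⟨j₀, mem_univ _, mul_pos hN (hx j₀)⟩
      rw [hNx] at h1
      have h2 : 0 < (splitM γ A *ᵥ x) r := pos_of_mul_pos_right h1 hρ
      linarith [sum_nonpos fun j (_ : j ∈ univ) => hterm i₀ hi₀ j]
    · have hN' : 1 ≤ splitCoeff γ r j₀ := by
        by_contra! h
        exact hN (by rw [splitN_apply]; exact mul_pos (by linarith) (by linarith))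
      have hγ : γ = 1 ∧ j₀ < r := by
        rw [splitCoeff, if_neg hj₀r.symm] at hN'
        split_ifs at hN' with h
        · exact ⟨le_antisymm hγ1 hN', h⟩
        · norm_num at hN'
      have hji : j₀ ≤ i₀ := by
        rcases hij with h | h | h
        · exact absurd hγ.1 h.ne
        · exact h
        · exact absurd h hγ.2.not_gt
      have hcoeff : splitCoeff γ i₀ j₀ = 1 := by
        rw [splitCoeff, hγ.1]
        split_ifs with h1 h2
        · rfl
        · rfl
        · exact absurd (lt_of_le_of_ne hji (Ne.symm h1)) h2
      have h1 : ∑ j, splitCoeff γ i₀ j * A r j * x j < 0 := by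
        refine sum_neg' (fun j _ => hterm i₀ hi₀ j) ⟨j₀, mem_univ _, ?_⟩
        rw [hcoeff, one_mul]
        exact mul_neg_of_neg_of_pos hj₀ (hx j₀)
      linarith [hMx r]
  have hwz : w ⬝ᵥ z < 0 :=
    sum_neg' (fun i _ => mul_nonpos_of_nonneg_of_nonpos (hw_nonneg i) (hz0 i))
      ⟨i₀, mem_univ _, mul_neg_of_pos_of_neg (hw i₀ (hS i₀ hi₀)) hzneg⟩
  have hpos : 0 < (w ᵥ* splitM γ (A15 A r α)) ⬝ᵥ x := by
    obtain ⟨k, hk⟩ := Function.ne_iff.mp hMw0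
    exact sum_pos' (fun i _ => mul_nonneg (hMw i) (hx i).le)
      ⟨k, mem_univ _, mul_pos (lt_of_le_of_ne (hMw k) (Ne.symm hk)) (hx k)⟩
  have hAx : A *ᵥ x = (1 - ρ) • (splitM γ A *ᵥ x) := by
    rw [sub_smul, one_smul, ← hNx, ← sub_mulVec, splitM_sub_splitN]
  have hNx' : splitN γ (A15 A r α) *ᵥ x =
      ρ • (splitM γ (A15 A r α) *ᵥ x) + (1 - ρ) • z := by
    have h1 : splitN γ (A15 A r α) = splitM γ (A15 A r α) - A15 A r α := by
      nth_rw 3 [← splitM_sub_splitN γ (A15 A r α)]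
      rw [sub_sub_cancel]
    have h2 : A15 A r α *ᵥ x = (1 - ρ) • (((1 + Q15 A r α) * splitM γ A) *ᵥ x) := by
      rw [A15, ← mulVec_mulVec, hAx, mulVec_smul, mulVec_mulVec]
    rw [h1, sub_mulVec, h2, hz]
    module
  have key : (ρ' - ρ) * ((w ᵥ* splitM γ (A15 A r α)) ⬝ᵥ x) = (1 - ρ) * (w ⬝ᵥ z) := by
    have h1 : w ⬝ᵥ (splitN γ (A15 A r α) *ᵥ x) =
        ρ' * ((w ᵥ* splitM γ (A15 A r α)) ⬝ᵥ x) := by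
      rw [dotProduct_mulVec, hNw, smul_dotProduct, smul_eq_mul]
    rw [hNx', dotProduct_add, dotProduct_smul, dotProduct_smul, dotProduct_mulVec, smul_eq_mul,
      smul_eq_mul] at h1
    linarith
  have hω : 0 ≤ 1 - ω := sub_nonneg.mpr hω1
  rcases lt_trichotomy ρ 1 with h | h | h
  · have h1 : ρ' < ρ := by
      by_contra! hle
      nlinarith [mul_nonneg (sub_nonneg.mpr hle) hpos.le, mul_neg_of_pos_of_neg (sub_pos.mpr h) hwz]
    -- For `ω = 1` the larger radius is `ρ` itself; strictness under `ENNReal.ofReal` needs it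
    -- positive.
    have hρ0 : 0 < ρ := hρ'.trans_lt h1
    refine Or.inl ⟨(ENNReal.ofReal_lt_ofReal_iff (by positivity)).mpr ?_,
      ENNReal.ofReal_lt_one.mpr ?_⟩ <;> nlinarith
  · have h1 : ρ' = 1 := by
      rw [h, sub_self, zero_mul] at key
      exact sub_eq_zero.mp ((mul_eq_zero.mp key).resolve_right hpos.ne')
    refine Or.inr (Or.inl ⟨by rw [h, h1], ?_⟩)
    rw [h, mul_one, sub_add_cancel, ENNReal.ofReal_one]
  · have h1 : ρ < ρ' := by
      by_contra! hle
      nlinarith [mul_nonneg (sub_nonneg.mpr hle) hpos.le,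
        mul_pos_of_neg_of_neg (sub_neg.mpr h) hwz]
    have hρ0 : 0 < ρ' := hρ.trans_lt h1
    refine Or.inr (Or.inr ⟨(ENNReal.ofReal_lt_ofReal_iff (by positivity)).mpr ?_,
      ENNReal.one_lt_ofReal.mpr ?_⟩) <;> nlinarith

/-- Preconditioning creates no off-diagonal zero: above the diagonal, column `r` is scaled by `1 - α
i > 0`, and the other nonpositive entries can only decrease. -/
theorem isIrreducible_A15_of_lt_one (hA : IsLMatrix A) (hAdiag : ∀ i, A i i = 1)
    (hirr : IsIrreducible A) (hα0 : ∀ k, k < r → 0 ≤ α k) (hα1 : ∀ k, k < r → α k < 1) :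
    IsIrreducible (A15 A r α) := by
  rintro ⟨σ, m, hm, hmn, hzero⟩
  refine hirr ⟨σ, m, hm, hmn, fun i j hi hj => ?_⟩
  have h := hzero i j hi hj
  rw [submatrix_apply] at h ⊢
  have hij : σ i ≠ σ j := fun hσ => by
    rw [σ.injective hσ] at hi
    omega
  by_cases hj : σ j = r
  · rw [hj] at h ⊢
    rcases lt_or_ge (σ i) r with hi | hi
    · rw [A15_apply_col hAdiag hi] at h
      exact (mul_eq_zero.mp h).resolve_left (sub_pos.mpr (hα1 _ hi)).ne'
    · rwa [A15_apply_of_le hi] at h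
  · exact le_antisymm (hA.1 _ _ hij) (h ▸ A15_apply_le hA hα0 hj)

/-- If `r` is the last index and all `α k` are positive, then the preconditioned matrix is
irreducible on the indices below `r`. -/
theorem exists_A15_ne_zero_of_last (hA : IsLMatrix A) (hirr : IsIrreducible A)
    (hlast : ∀ i, i ≠ r → i < r) (hα0 : ∀ k, k < r → 0 < α k)
    {Y : Set (Fin n)} (hY : Y.Nonempty) (hYr : r ∉ Y) {l : Fin n} (hlY : l ∉ Y) (hlr : l ≠ r) :
    ∃ i ∈ Y, ∃ j ∉ Y, j ≠ r ∧ A15 A r α i j ≠ 0 := by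
  by_contra! hcon
  have hlt : ∀ i ∈ Y, i < r := fun i hi => hlast i fun h => hYr (h ▸ hi)
  have hne : ∀ {i j}, i ∈ Y → j ∉ Y → i ≠ j := fun hi hj h => hj (h ▸ hi)
  have hzero : ∀ i ∈ Y, ∀ j ∉ Y, j ≠ r → A i j = 0 := fun i hi j hj hjr =>
    le_antisymm (hA.1 i j (hne hi hj))
      (hcon i hi j hj hjr ▸ A15_apply_le hA (fun k hk => (hα0 k hk).le) hjr)
  obtain ⟨i, hi, j, hj, hij⟩ := hirr.exists_ne_zero hY ⟨r, hYr⟩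
  have hjr : j = r := by
    by_contra h
    exact hij (hzero i hi j hj h)
  subst hjr
  -- In `A` the set `Y` leads only to the last index, and from there to some `m` outside. The
  -- preconditioner turns this path of length two into a nonzero entry in row `i`, column `m`.
  obtain ⟨k, hk, m, hm, hkm⟩ := hirr.exists_ne_zero (Y := insert j Y) (Set.insert_nonempty _ _)
    ⟨l, by simp [hlr, hlY]⟩
  have hmj : m ≠ j := fun h => hm (Set.mem_insert_iff.mpr (Or.inl h))
  have hmY : m ∉ Y := fun h => hm (Set.mem_insert_of_mem _ h)
  rcases hk with rfl | hk
  · have h := hcon i hi m hmY hmj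
    rw [A15_apply, hzero i hi m hmY hmj, precCoeff, if_pos (hlt i hi), zero_add, mul_eq_zero,
      neg_eq_zero, mul_eq_zero] at h
    rcases h with (h | h) | h
    · exact (hα0 i (hlt i hi)).ne' h
    · exact hij h
    · exact hkm h
  · exact hkm (hzero k hk m hmY hmj)

/-- The set of indices on which the preconditioned matrix is irreducible. -/
theorem exists_irreducible_support (hA : IsLMatrix A) (hirr : IsIrreducible A)
    (hlast : ∀ i, i ≠ r → i < r)
    (hα0 : ∀ k, k < r → 0 < α k) :
    ∃ S : Set (Fin n), (∀ i, i < r → i ∈ S) ∧ (∀ j ∉ S, ∀ i, i ≠ j → A15 A r α i j = 0) ∧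
      ∀ Y ⊆ S, Y.Nonempty → (S \ Y).Nonempty → ∃ i ∈ Y, ∃ j ∈ S \ Y, A15 A r α i j ≠ 0 := by
  -- Only a column `r` that is zero off the diagonal obstructs irreducibility; index `r` is then
  -- dropped from `S`.
  by_cases hcol : ∀ i, i ≠ r → A15 A r α i r = 0
  · refine ⟨{i | i ≠ r}, fun i hi => hi.ne, fun j hj i hi => ?_, fun Y hYS hY hYc => ?_⟩
    · rw [not_not.mp hj] at hi ⊢
      exact hcol i hi
    · obtain ⟨l, hlS, hlY⟩ := hYc
      obtain ⟨i, hi, j, hj, hjr, hij⟩ := exists_A15_ne_zero_of_last hA hirr hlast hα0 hY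
        (fun h => hYS h rfl) hlY hlS
      exact ⟨i, hi, j, ⟨hjr, hj⟩, hij⟩
  · push Not at hcol
    obtain ⟨k, hkr, hk⟩ := hcol
    refine ⟨Set.univ, fun _ _ => Set.mem_univ _, fun j hj => absurd (Set.mem_univ j) hj,
      fun Y _ hY hYc => ?_⟩
    suffices h : ∃ i ∈ Y, ∃ j ∉ Y, A15 A r α i j ≠ 0 by simpa using h
    by_cases hrY : r ∈ Y
    · by_cases hY' : Y = {r}
      · obtain ⟨i, hi, j, hj, hij⟩ := hirr.exists_ne_zero hY
          (by rwa [← Set.compl_eq_univ_sdiff] at hYc)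
        refine ⟨i, hi, j, hj, ?_⟩
        rw [hY', Set.mem_singleton_iff] at hi
        rwa [A15_apply_of_le hi.ge]
      · obtain ⟨l, hl⟩ := hYc
        have hlr : l ≠ r := fun h => hl.2 (h ▸ hrY)
        obtain ⟨i, hi, hir⟩ : ∃ i ∈ Y, i ≠ r := by
          by_contra! h
          exact hY' (Set.eq_singleton_iff_unique_mem.mpr ⟨hrY, h⟩)
        obtain ⟨i, hi, j, hj, hjr, hij⟩ := exists_A15_ne_zero_of_last hA hirr hlast hα0
          (Y := Y \ {r}) ⟨i, hi, hir⟩ (by simp) (l := l) (fun h => hl.2 h.1) hlr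
        exact ⟨i, hi.1, j, fun h => hj ⟨h, hjr⟩, hij⟩
    · by_cases hY' : ∃ l, l ∉ Y ∧ l ≠ r
      · obtain ⟨l, hl, hlr⟩ := hY'
        obtain ⟨i, hi, j, hj, -, hij⟩ := exists_A15_ne_zero_of_last hA hirr hlast hα0 hY hrY hl hlr
        exact ⟨i, hi, j, hj, hij⟩
      · push Not at hY'
        exact ⟨k, by_contra fun h => hkr (hY' k h), r, hrY, hk⟩

end PrecAOR

/-! ### Reduction of the cases to one pair of indices and one support set -/

/-- Indices are zero-based: `r : Fin n` with `0 < r` is the column index, the first index is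
`⟨0, r.pos⟩`, and `r` is the last index iff `(r : ℕ) + 1 = n`. -/
theorem theorem3p59 {n : ℕ} (A : Matrix (Fin n) (Fin n) ℝ)
    (hAL : PrecAOR.IsLMatrix A) (hAirr : PrecAOR.IsIrreducible A) (hAdiag : ∀ i, A i i = 1)
    (γ ω : ℝ) (hω0 : 0 < ω) (hω1 : ω ≤ 1) (hγ0 : 0 ≤ γ) (hγ1 : γ ≤ 1)
    (r : Fin n) (hr : 0 < (r : ℕ))
    (α : Fin n → ℝ) (hα0 : ∀ k, k < r → 0 ≤ α k)
    (hαsum : ∑ k ∈ Finset.univ.filter (fun k : Fin n => k < r), α k * A k r ≠ 0)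
    (hα : ∀ k, k < r → α k * A k r * A r k < 1)
    (hcond :
      -- (i)
      (γ < 1 ∧ ∀ k, k < r → PrecAOR.LessSim (PrecAOR.A15 A r α) (α k) 1) ∨
      -- (ii)
      (γ = 1 ∧ (∀ k, k < r → PrecAOR.LessSim (PrecAOR.A15 A r α) (α k) 1) ∧
        ((∃ i j : Fin n, i < r ∧ (j ≤ i ∨ r < j) ∧ 0 < α i * A i r * A r j) ∨
         (∃ k : Fin n, (k : ℕ) + 1 = (r : ℕ) ∧ A k r < 0 ∧ 0 < α k) ∨
         (A r ⟨0, r.pos⟩ < 0) ∨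
         (∃ k : Fin n, r < k ∧ A r k < 0))) ∨
      -- (iii)
      ((r : ℕ) + 1 = n ∧ γ < 1 ∧ ∀ k, k < r → 0 < α k ∧ α k ≤ 1) ∨
      -- (iv)
      ((r : ℕ) + 1 = n ∧ γ = 1 ∧ (∀ k, k < r → 0 < α k ∧ α k ≤ 1) ∧
        ((∃ i j : Fin n, i < r ∧ j ≤ i ∧ 0 < A i r * A r j) ∨
         (∃ k : Fin n, (k : ℕ) + 1 = (r : ℕ) ∧ A k r < 0) ∨
         (A r ⟨0, r.pos⟩ < 0)))) :
    (PrecAOR.rho (PrecAOR.aor γ ω (PrecAOR.A15 A r α)) < PrecAOR.rho (PrecAOR.aor γ ω A) ∧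
        PrecAOR.rho (PrecAOR.aor γ ω A) < 1) ∨
    (PrecAOR.rho (PrecAOR.aor γ ω (PrecAOR.A15 A r α)) = PrecAOR.rho (PrecAOR.aor γ ω A) ∧
        PrecAOR.rho (PrecAOR.aor γ ω A) = 1) ∨
    (PrecAOR.rho (PrecAOR.aor γ ω (PrecAOR.A15 A r α)) > PrecAOR.rho (PrecAOR.aor γ ω A) ∧
        PrecAOR.rho (PrecAOR.aor γ ω A) > 1) := by
  have hle : ∀ k, k < r → α k * A k r ≤ 0 := fun k hk =>
    mul_nonpos_of_nonneg_of_nonpos (hα0 k hk) (hAL.1 k r hk.ne)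
  obtain ⟨i₁, hi₁, hc₁⟩ : ∃ i, i < r ∧ α i * A i r < 0 := by
    obtain ⟨k, hk, hk0⟩ := Finset.exists_ne_zero_of_sum_ne_zero hαsum
    have hkr : k < r := by simpa using hk
    exact ⟨k, hkr, lt_of_le_of_ne (hle k hkr) hk0⟩
  obtain ⟨j₁, hj₁r, hj₁⟩ : ∃ j, j ≠ r ∧ A r j < 0 := by
    obtain ⟨i, hi, j, hj, hij⟩ := hAirr.exists_ne_zero (Set.singleton_nonempty r) ⟨i₁, hi₁.ne⟩
    rw [Set.mem_singleton_iff] at hi hj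
    subst hi
    exact ⟨j, hj, lt_of_le_of_ne (hAL.1 i j (Ne.symm hj)) hij⟩
  have hfirst : ∀ i : Fin n, (⟨0, r.pos⟩ : Fin n) ≤ i := fun i => Nat.zero_le _
  have h0r : (⟨0, r.pos⟩ : Fin n) ≠ r := fun h => hr.ne (congrArg Fin.val h)
  have hprod : ∀ i j : Fin n, i < r → (j ≤ i ∨ r < j) → 0 < α i * A i r * A r j →
      α i * A i r < 0 ∧ A r j < 0 ∧ j ≠ r := fun i j hi hj h => by
    have hjr : j ≠ r := by
      rcases hj with hj | hj
      · exact (hj.trans_lt hi).ne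
      · exact hj.ne'
    refine ⟨lt_of_le_of_ne (hle i hi) fun h0 => ?_,
      lt_of_le_of_ne (hAL.1 r j hjr.symm) fun h0 => ?_, hjr⟩
    · rw [h0, zero_mul] at h
      exact h.false
    · rw [h0, mul_zero] at h
      exact h.false
  -- No index lies strictly between `r - 1` and `r`, so with `i₀ = r - 1` any off-diagonal nonzero
  -- entry of row `r` is admissible.
  have hpred : ∀ k : Fin n, (k : ℕ) + 1 = r → j₁ ≤ k ∨ r < j₁ := fun k hk => by
    rcases lt_or_gt_of_ne hj₁r with h | h
    · exact Or.inl (Fin.le_def.mpr (by have := Fin.lt_def.mp h; omega))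
    · exact Or.inr h
  have hpred' : ∀ k : Fin n, (k : ℕ) + 1 = r → k < r := fun k hk => Fin.lt_def.mpr (by omega)
  have hα1 : ∀ k, k < r → α k ≤ 1 := fun k hk => by
    rcases hcond with h | h | h | h
    · exact (h.2 k hk).elim le_of_lt fun h => h.1.le
    · exact (h.2.1 k hk).elim le_of_lt fun h => h.1.le
    · exact (h.2.2 k hk).2
    · exact (h.2.2.1 k hk).2
  obtain ⟨i₀, j₀, hi₀, hc, hj₀, hj₀r, hij⟩ : ∃ i j : Fin n, i < r ∧ α i * A i r < 0 ∧ A r j < 0 ∧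
      j ≠ r ∧ (γ < 1 ∨ j ≤ i ∨ r < j) := by
    rcases hcond with h | ⟨-, -, h⟩ | h | ⟨-, -, hpos, h⟩
    · exact ⟨i₁, j₁, hi₁, hc₁, hj₁, hj₁r, Or.inl h.1⟩
    · rcases h with ⟨i, j, hi, hj, h⟩ | ⟨k, hk, hk0, hαk⟩ | h | ⟨k, hk, h⟩
      · obtain ⟨h1, h2, h3⟩ := hprod i j hi hj h
        exact ⟨i, j, hi, h1, h2, h3, Or.inr hj⟩
      · exact ⟨k, j₁, hpred' k hk, mul_neg_of_pos_of_neg hαk hk0, hj₁, hj₁r, Or.inr (hpred k hk)⟩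
      · exact ⟨i₁, _, hi₁, hc₁, h, h0r, Or.inr (Or.inl (hfirst i₁))⟩
      · exact ⟨i₁, k, hi₁, hc₁, h, hk.ne', Or.inr (Or.inr hk)⟩
    · exact ⟨i₁, j₁, hi₁, hc₁, hj₁, hj₁r, Or.inl h.2.1⟩
    · rcases h with ⟨i, j, hi, hj, h⟩ | ⟨k, hk, hk0⟩ | h
      · obtain ⟨h1, h2, h3⟩ := hprod i j hi (Or.inl hj)
          (by rw [mul_assoc]; exact mul_pos (hpos i hi).1 h)
        exact ⟨i, j, hi, h1, h2, h3, Or.inr (Or.inl hj)⟩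
      · exact ⟨k, j₁, hpred' k hk, mul_neg_of_pos_of_neg (hpos k (hpred' k hk)).1 hk0, hj₁, hj₁r,
          Or.inr (hpred k hk)⟩
      · exact ⟨i₁, _, hi₁, hc₁, h, h0r, Or.inr (Or.inl (hfirst i₁))⟩
  obtain ⟨S, hS, hcol, hirr⟩ : ∃ S : Set (Fin n), (∀ i, i < r → i ∈ S) ∧
      (∀ j ∉ S, ∀ i, i ≠ j → PrecAOR.A15 A r α i j = 0) ∧
      ∀ Y ⊆ S, Y.Nonempty → (S \ Y).Nonempty →
        ∃ i ∈ Y, ∃ j ∈ S \ Y, PrecAOR.A15 A r α i j ≠ 0 := by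
    -- Either all `α k < 1`, and irreducibility is inherited from `A`, or some `α k = 1`, and
    -- `LessSim` supplies it.
    have hsim : (∀ k, k < r → PrecAOR.LessSim (PrecAOR.A15 A r α) (α k) 1) →
        PrecAOR.IsIrreducible (PrecAOR.A15 A r α) := fun h => by
      by_cases h1 : ∀ k, k < r → α k < 1
      · exact PrecAOR.isIrreducible_A15_of_lt_one hAL hAdiag hAirr hα0 h1
      · push Not at h1
        obtain ⟨k, hk, hk1⟩ := h1
        exact ((h k hk).resolve_left hk1.not_gt).2
    have huniv : PrecAOR.IsIrreducible (PrecAOR.A15 A r α) → _ := fun h =>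
      (⟨Set.univ, fun _ _ => Set.mem_univ _, fun j hj => absurd (Set.mem_univ j) hj,
        fun Y _ hY hYc => by
          simpa using h.exists_ne_zero hY (by rwa [← Set.compl_eq_univ_sdiff] at hYc)⟩ :
        ∃ S : Set (Fin n), (∀ i, i < r → i ∈ S) ∧
          (∀ j ∉ S, ∀ i, i ≠ j → PrecAOR.A15 A r α i j = 0) ∧
          ∀ Y ⊆ S, Y.Nonempty → (S \ Y).Nonempty →
            ∃ i ∈ Y, ∃ j ∈ S \ Y, PrecAOR.A15 A r α i j ≠ 0)
    have hlast : (r : ℕ) + 1 = n → ∀ i, i ≠ r → i < r := fun h i hi =>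
      lt_of_le_of_ne (Fin.le_def.mpr (by have := i.isLt; omega)) hi
    rcases hcond with h | h | h | h
    · exact huniv (hsim h.2)
    · exact huniv (hsim h.2.1)
    · exact PrecAOR.exists_irreducible_support hAL hAirr (hlast h.1)
        fun k hk => (h.2.2 k hk).1
    · exact PrecAOR.exists_irreducible_support hAL hAirr (hlast h.1)
        fun k hk => (h.2.2.1 k hk).1
  exact PrecAOR.rho_aor_A15_trichotomy hAL hAirr
    (PrecAOR.isLMatrix_A15 hAL hAdiag hα0 hα1 hα) hω0 hω1 hγ0 hγ1 hα0 hi₀ hc hj₀ hj₀r hij hS hcol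
    hirr
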